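/- Let $P$ be an associative ring with identity. For a locally finite preordered set $\Lambda$ (every interval $[s,t]=\{r: s\preceq r\preceq t\}$ is finite), let $\mathrm{M}_\Lambda(P)$ be the incidence ring of $\Lambda$ over $P$: the set of all $(a_{s,t})\in P^{\Lambda\times\Lambda}$ with $a_{s,t}=0$ whenever $s\not\preceq t$, with coordinatewise addition and with product $(ab)_{s,t}=\sum_{r\in[s,t]}a_{s,r}b_{r,t}$. If $P$ is a topological ring, then $\mathrm{M}_\Lambda(P)$ carries the subspace topology of $P^{\Lambda\times\Lambda}$. For $m,n\in\mathbb{N}=\{0,1,2,\dots\}$ let $\mathbf{m}\leftarrow\mathbf{n}$ be the preordered set with elements $0',\dots,(m-1)',0,\dots,n-1$ in which the primed elements are pairwise equivalent, the unprimed elements are pairwise equivalent, and every primed element is strictly below every unprimed one. Then the class of incidence rings over $P$ is generated by the rings $\mathrm{M}_{\mathbf{m}\leftarrow\mathbf{n}}(P)$, $m,n\in\mathbb{N}$, under products, inverse limits and pullbacks, in the following sense. 1. For every locally finite partially ordered set $\Lambda$, the ring $\mathrm{M}_\Lambda(P)$ belongs to the smallest class of rings that contains all $\mathrm{M}_{\mathbf{m}\leftarrow\mathbf{n}}(P)$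 and is closed under isomorphisms, arbitrary products, inverse limits over (non-empty) directed sets, and pullbacks (the limits being taken in the category of rings and unital ring homomorphisms). 2. The class of all rings isomorphic to $\mathrm{M}_\Lambda(P)$ for some locally finite preordered set $\Lambda$ is equal to the smallest class of rings that contains all $\mathrm{M}_{\mathbf{m}\leftarrow\mathbf{n}}(P)$ and contains every incidence ring over $P$ that is a product, an inverse limit over a directed set, or a pullback of rings of the class. If $P$ is a topological ring, then 1 and 2 also hold for topological rings, with isomorphisms and limits taken in the category of topological rings and continuous unital ring homomorphisms. -/

import Mathlib

open CategoryTheory CategoryTheory.Limits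

universe u v w

/-- The underlying set `{0', …, (m-1)', 0, …, n-1}` of the preordered set `m ← n`. -/
def TwoBlock (m n : ℕ) : Type := Fin m ⊕ Fin n

namespace TwoBlock

instance instDecidableEq (m n : ℕ) : DecidableEq (TwoBlock m n) := inferInstanceAs (DecidableEq (Fin m ⊕ Fin n))

instance instFintype (m n : ℕ) : Fintype (TwoBlock m n) := inferInstanceAs (Fintype (Fin m ⊕ Fin n))

/-- The primed elements are pairwise equivalent, the unprimed elements are pairwise equivalent, and
every primed element is strictly below every unprimed one: the order is pulled back from
`false < true` along the map that tells the unprimed elements from the primed ones. -/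
instance instPreorder (m n : ℕ) : Preorder (TwoBlock m n) := Preorder.lift (fun x => Sum.isRight x)

instance instDecidableLE (m n : ℕ) : DecidableLE (TwoBlock m n) :=
  fun x y => inferInstanceAs (Decidable (Sum.isRight x ≤ Sum.isRight y))

instance instLocallyFiniteOrder (m n : ℕ) : LocallyFiniteOrder (TwoBlock m n) :=
  Fintype.toLocallyFiniteOrder

end TwoBlock

namespace IncidenceAlgebra

variable {P : Type u} {Λ : Type v} [Ring P] [TopologicalSpace P]

/-- The subspace topology of `P ^ (Λ × Λ)` on the incidence ring. -/
instance instTopologicalSpace [LE Λ] : TopologicalSpace (IncidenceAlgebra P Λ) :=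
  TopologicalSpace.induced (fun A (s t : Λ) => A s t) inferInstance

theorem continuous_apply_apply [LE Λ] (s t : Λ) :
    Continuous fun A : IncidenceAlgebra P Λ => A s t :=
  (continuous_apply t).comp ((continuous_apply s).comp continuous_induced_dom)

theorem continuous_of_apply [LE Λ] {X : Type w} [TopologicalSpace X]
    {f : X → IncidenceAlgebra P Λ} (h : ∀ s t, Continuous fun x => f x s t) : Continuous f :=
  continuous_induced_rng.2 (continuous_pi fun s => continuous_pi fun t => h s t)

instance instIsTopologicalRing [Preorder Λ] [LocallyFiniteOrder Λ] [DecidableEq Λ]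
    [IsTopologicalRing P] :
    IsTopologicalRing (IncidenceAlgebra P Λ) where
  continuous_add := continuous_of_apply fun s t =>
    ((continuous_apply_apply s t).comp continuous_fst).add
      ((continuous_apply_apply s t).comp continuous_snd)
  continuous_mul := continuous_of_apply fun s t => by
    simp only [mul_apply]
    exact continuous_finsetSum _ fun r _ =>
      ((continuous_apply_apply s r).comp continuous_fst).mul
        ((continuous_apply_apply r t).comp continuous_snd)
  continuous_neg := continuous_of_apply fun s t => (continuous_apply_apply s t).neg

end IncidenceAlgebra

/-- A bundled topological ring (associative, with identity, not necessarily commutative). -/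
structure TopRingCat where
  of ::
  carrier : Type u
  [ring : Ring carrier]
  [topologicalSpace : TopologicalSpace carrier]
  [isTopologicalRing : IsTopologicalRing carrier]

namespace TopRingCat

instance instCoeSort : CoeSort TopRingCat.{u} (Type u) := ⟨TopRingCat.carrier⟩

attribute [instance] ring topologicalSpace isTopologicalRing

/-- The morphisms of topological rings are the continuous (unital) ring homomorphisms. -/
instance instCategory : Category TopRingCat.{u} where
  Hom R S := { f : R →+* S // Continuous f }
  id R := ⟨RingHom.id R, continuous_id⟩
  comp f g := ⟨g.1.comp f.1, g.2.comp f.2⟩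

end TopRingCat

/-- `GeneratedWithin A G` is the smallest class of objects that contains `G` and contains every
object of `A` which is a product, an inverse limit over a directed set, or a pullback of a diagram
whose objects all lie in the class. With `A = ⊤` this is the class generated by `G` under products,
inverse limits and pullbacks. (Limits are meant up to isomorphism; for instance, an object that is
isomorphic to `X` is a product of the one-member family `X`.) -/
inductive GeneratedWithin {C : Type v} [Category.{u} C] (A G : ObjectProperty C) :
    ObjectProperty C
  | generator (X : C) (hX : G X) : GeneratedWithin A G X
  | product (I : Type u) (F : I → C) (c : Fan F) (hc : Nonempty (IsLimit c)) (hA : A c.pt)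
      (hF : ∀ i, GeneratedWithin A G (F i)) : GeneratedWithin A G c.pt
  | inverseLimit (I : Type u) [Preorder I] [IsDirectedOrder I] [Nonempty I] (F : Iᵒᵖ ⥤ C)
      (c : Cone F) (hc : Nonempty (IsLimit c)) (hA : A c.pt)
      (hF : ∀ i, GeneratedWithin A G (F.obj i)) : GeneratedWithin A G c.pt
  | pullback (W X Y Z : C) (fst : W ⟶ X) (snd : W ⟶ Y) (f : X ⟶ Z) (g : Y ⟶ Z)
      (h : IsPullback fst snd f g) (hA : A W) (hX : GeneratedWithin A G X)
      (hY : GeneratedWithin A G Y) (hZ : GeneratedWithin A G Z) : GeneratedWithin A G W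

/-- The rings `M_{m ← n}(P)`, for `m n : ℕ`. -/
def blockRings (P : Type u) [Ring P] : ObjectProperty RingCat.{u} :=
  fun R => ∃ m n : ℕ, R = RingCat.of (IncidenceAlgebra P (TwoBlock m n))

/-- The rings isomorphic to `M_Λ(P)` for some locally finite preordered set `Λ`. -/
def incidenceRings (P : Type u) [Ring P] : ObjectProperty RingCat.{u} :=
  fun R => ∃ (Λ : Type u) (_ : Preorder Λ) (_ : LocallyFiniteOrder Λ) (_ : DecidableEq Λ),
    Nonempty (R ≅ RingCat.of (IncidenceAlgebra P Λ))

/-- The topological rings `M_{m ← n}(P)`, for `m n : ℕ`. -/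
def topBlockRings (P : Type u) [Ring P] [TopologicalSpace P] [IsTopologicalRing P] :
    ObjectProperty TopRingCat.{u} :=
  fun R => ∃ m n : ℕ, R = TopRingCat.of (IncidenceAlgebra P (TwoBlock m n))

/-- The topological rings isomorphic to `M_Λ(P)` for some locally finite preordered set `Λ`. -/
def topIncidenceRings (P : Type u) [Ring P] [TopologicalSpace P] [IsTopologicalRing P] :
    ObjectProperty TopRingCat.{u} :=
  fun R => ∃ (Λ : Type u) (_ : Preorder Λ) (_ : LocallyFiniteOrder Λ) (_ : DecidableEq Λ),
    Nonempty (R ≅ TopRingCat.of (IncidenceAlgebra P Λ))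

/-! Two reductions carry the proof. First, the entry of a product at `(s, t)` involves only `[s,
t]`, so restriction to an order-convex subset is a ring homomorphism. The finite convex subsets of a
locally finite `Λ` are directed and contain every pair of points, so `M_Λ(P)` is the inverse limit
of their incidence rings (`nonempty_isLimit_cone`). Second, a preorder on a finite set is the
intersection of the preorders `x ∈ u → y ∈ u`, with `u` running through its principal upper sets.
Each of these has the form `m ← n`. Intersecting preorders intersects the incidence rings inside the
full matrix ring, which is a pullback (`isPullback_coarsenHom`); the full matrix ring is itself a
block ring with `m = 0`. Induction on the number of sets `u` finishes the finite case. Every ring on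
the way is an incidence ring, so one argument serves both claims. Plain rings follow by forgetting
the topology, which preserves limits. -/

namespace IncidenceAlgebra

theorem ordConnected_range_orderIso {α β : Type*} [Preorder α] [Preorder β] (e : α ≃o β) :
    (Set.range (e : α ↪o β)).OrdConnected := by
  rw [show Set.range (e : α ↪o β) = Set.univ from e.surjective.range_eq]
  exact Set.ordConnected_univ

/-! ### Restriction and inclusion maps between incidence rings -/

section Hom

variable {P : Type*} {α β : Type*} [Ring P]
  [Preorder α] [LocallyFiniteOrder α] [DecidableEq α]
  [Preorder β] [LocallyFiniteOrder β] [DecidableEq β]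

/-- Restriction of the incidence ring along an order embedding with order-convex range. -/
def restrict (f : α ↪o β) (hf : (Set.range f).OrdConnected) :
    IncidenceAlgebra P β →+* IncidenceAlgebra P α where
  toFun A := ⟨fun s t => A (f s) (f t), fun _ _ h =>
    apply_eq_zero_of_not_le (fun h' => h (f.le_iff_le.1 h')) A⟩
  map_zero' := rfl
  map_add' _ _ := rfl
  map_one' := by
    ext s t _
    simp [f.injective.eq_iff]
  map_mul' A B := by
    ext s t _
    simp only [mul_apply, coe_mk]
    refine (Finset.sum_nbij f ?_ f.injective.injOn ?_ fun _ _ => rfl).symm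
    · intro r hr
      simpa using hr
    · intro r hr
      rw [Finset.mem_coe, Finset.mem_Icc] at hr
      -- Convexity of the range is what makes `[f s, f t]` the image of `[s, t]`, so that no term of
      -- the product is lost.
      obtain ⟨q, rfl⟩ := hf.out ⟨s, rfl⟩ ⟨t, rfl⟩ hr
      exact ⟨q, by simpa using hr, rfl⟩

theorem restrict_apply (f : α ↪o β) (hf : (Set.range f).OrdConnected)
    (A : IncidenceAlgebra P β) (s t : α) : restrict f hf A s t = A (f s) (f t) :=
  rfl

theorem continuous_restrict [TopologicalSpace P] (f : α ↪o β) (hf : (Set.range f).OrdConnected) :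
    Continuous (restrict (P := P) f hf) :=
  continuous_of_apply fun s t => continuous_apply_apply (f s) (f t)

/-- The inclusion of an incidence ring into that of a coarser preorder. -/
def extend (f : α ≃ β) (hf : Monotone f) :
    IncidenceAlgebra P α →+* IncidenceAlgebra P β where
  toFun A := ⟨fun s t => A (f.symm s) (f.symm t), fun s t h =>
    apply_eq_zero_of_not_le (fun h' => h (by simpa using hf h')) A⟩
  map_zero' := rfl
  map_add' _ _ := rfl
  map_one' := by
    ext s t _
    simp
  map_mul' A B := by
    ext s t _
    simp only [mul_apply, coe_mk]
    -- The interval may be larger in the coarser preorder, but each additional term has a factor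
    -- supported outside the finer one, hence zero.
    rw [← Finset.sum_subset (s₁ := (Finset.Icc (f.symm s) (f.symm t)).map f.toEmbedding)]
    · simp
    · intro r hr
      rw [Finset.mem_map_equiv, Finset.mem_Icc] at hr
      exact Finset.mem_Icc.2 ⟨by simpa using hf hr.1, by simpa using hf hr.2⟩
    · intro r _ hr
      rw [Finset.mem_map_equiv, Finset.mem_Icc, not_and_or] at hr
      rcases hr with hr | hr
      · rw [apply_eq_zero_of_not_le hr, zero_mul]
      · rw [apply_eq_zero_of_not_le hr, mul_zero]

theorem continuous_extend [TopologicalSpace P] (f : α ≃ β) (hf : Monotone f) :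
    Continuous (extend (P := P) f hf) :=
  continuous_of_apply fun s t => continuous_apply_apply (f.symm s) (f.symm t)

end Hom

end IncidenceAlgebra

/-! ### Limits of topological rings -/

namespace TopRingCat

/-- The forgetful functor from topological rings to rings. -/
def forgetTopology : TopRingCat.{u} ⥤ RingCat.{u} where
  obj R := RingCat.of R
  map f := RingCat.ofHom f.1

/-- The functor that equips a ring with the discrete topology. -/
def discrete : RingCat.{u} ⥤ TopRingCat.{u} where
  obj R :=
    letI : TopologicalSpace R := ⊥
    haveI : DiscreteTopology R := ⟨rfl⟩
    TopRingCat.of R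
  map f := ⟨f.hom, continuous_bot⟩

/-- The discrete topology is left adjoint to forgetting the topology. -/
def discreteAdjunction : discrete.{u} ⊣ forgetTopology.{u} :=
  Adjunction.mkOfHomEquiv
    { homEquiv := fun _ _ =>
        { toFun := fun f => RingCat.ofHom f.1
          invFun := fun f => ⟨f.hom, continuous_bot⟩
          left_inv := fun _ => rfl
          right_inv := fun _ => rfl }
      homEquiv_naturality_left_symm := fun _ _ => rfl
      homEquiv_naturality_right := fun _ _ => rfl }

/-- A ring isomorphism that is a homeomorphism is an isomorphism of topological rings. -/
def isoMk {R S : TopRingCat.{u}} (f : R →+* S) (g : S →+* R) (hf : Continuous f)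
    (hg : Continuous g) (hfg : ∀ x, g (f x) = x) (hgf : ∀ y, f (g y) = y) : R ≅ S where
  hom := ⟨f, hf⟩
  inv := ⟨g, hg⟩
  hom_inv_id := Subtype.ext (RingHom.ext hfg)
  inv_hom_id := Subtype.ext (RingHom.ext hgf)

theorem comp_apply {R S T : TopRingCat.{u}} (f : R ⟶ S) (g : S ⟶ T) (x : R) :
    (f ≫ g).1 x = g.1 (f.1 x) :=
  rfl

/-- A cone of topological rings is a limit cone if its points correspond to the compatible families
and its topology is the initial one. -/
theorem nonempty_isLimit {J : Type w} [Category.{v} J] {F : J ⥤ TopRingCat.{u}} (c : Cone F)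
    (hinj : ∀ x y : c.pt, (∀ j, (c.π.app j).1 x = (c.π.app j).1 y) → x = y)
    (hsurj : ∀ x : ∀ j, F.obj j, (∀ {i j} (f : i ⟶ j), (F.map f).1 (x i) = x j) →
      ∃ y : c.pt, ∀ j, (c.π.app j).1 y = x j)
    (hcont : ∀ (T : TopRingCat.{u}) (f : T → c.pt),
      (∀ j, Continuous fun t => (c.π.app j).1 (f t)) → Continuous f) :
    Nonempty (IsLimit c) := by
  have key (s : Cone F) (t : s.pt) : ∃ y : c.pt, ∀ j, (c.π.app j).1 y = (s.π.app j).1 t :=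
    hsurj _ fun {i j} f => by rw [← comp_apply, s.w]
  choose l hl using key
  exact ⟨{
    lift := fun s => ⟨
      { toFun := l s
        map_zero' := hinj _ _ fun j => by simp only [hl, map_zero]
        map_one' := hinj _ _ fun j => by simp only [hl, map_one]
        map_add' := fun x y => hinj _ _ fun j => by simp only [hl, map_add]
        map_mul' := fun x y => hinj _ _ fun j => by simp only [hl, map_mul] },
      hcont _ _ fun j => (s.π.app j).2.congr fun t => (hl s t j).symm⟩
    fac := fun s j => Subtype.ext (RingHom.ext fun t => hl s t j)
    uniq := fun s m hm => Subtype.ext (RingHom.ext fun t => hinj _ _ fun j =>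
      ((congrArg (fun f => f.1 t) (hm j)).trans (hl s t j).symm :)) }⟩

end TopRingCat

/-! ### Formal properties of generated classes -/

namespace GeneratedWithin

variable {C : Type*} [Category.{u} C] {A A' G : ObjectProperty C}

theorem mono (h : A ≤ A') : GeneratedWithin A G ≤ GeneratedWithin A' G := by
  intro X hX
  induction hX with
  | generator X hX => exact generator X hX
  | product I F c hc hA _ ih => exact product I F c hc (h _ hA) ih
  | inverseLimit I F c hc hA _ ih => exact inverseLimit I F c hc (h _ hA) ih
  | pullback W X Y Z fst snd f g hp hA _ _ _ ihX ihY ihZ =>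
    exact pullback W X Y Z fst snd f g hp (h _ hA) ihX ihY ihZ

theorem le_of_le (h : G ≤ A) : GeneratedWithin A G ≤ A := by
  intro X hX
  cases hX with
  | generator X hX => exact h _ hX
  | product I F c hc hA => exact hA
  | inverseLimit I F c hc hA => exact hA
  | pullback W X Y Z fst snd f g hp hA => exact hA

/-- An isomorphism onto `Y` exhibits its source as a pullback of two identities of `Y`. -/
theorem of_iso {X Y : C} (e : X ≅ Y) (hA : A X) (hY : GeneratedWithin A G Y) :
    GeneratedWithin A G X :=
  pullback X Y Y Y e.hom e.hom (𝟙 Y) (𝟙 Y) (IsPullback.of_vert_isIso ⟨rfl⟩) hA hY hY hY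

/-- Products and inverse limits have index categories in universe `u`, while the cospan of a
pullback lives in universe `0`; hence the two preservation assumptions. -/
theorem map {D : Type*} [Category.{u} D] {B H : ObjectProperty D} (U : C ⥤ D)
    [PreservesLimitsOfSize.{u, u} U] [PreservesLimitsOfSize.{0, 0} U]
    (hAB : ∀ X, A X → B (U.obj X)) (hGH : ∀ X, G X → H (U.obj X)) {X : C}
    (hX : GeneratedWithin A G X) : GeneratedWithin B H (U.obj X) := by
  induction hX with
  | generator X hX => exact generator _ (hGH _ hX)
  | product I F c hc hA _ ih =>
    refine product I (fun i => U.obj (F i)) (Fan.mk (U.obj c.pt) fun i => U.map (c.proj i))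
      ?_ (hAB _ hA) ih
    obtain ⟨hc⟩ := hc
    exact ⟨isLimitFanMkObjOfIsLimit U F _
      (hc.ofIsoLimit (Cone.ext (Iso.refl _) fun ⟨i⟩ => by simp [Fan.proj]))⟩
  | inverseLimit I F c hc hA _ ih =>
    exact inverseLimit I (F ⋙ U) (U.mapCone c) (hc.map fun h => isLimitOfPreserves U h)
      (hAB _ hA) ih
  | pullback W X Y Z fst snd f g hp hA _ _ _ ihX ihY ihZ =>
    exact pullback _ _ _ _ _ _ _ _ (hp.map U) (hAB _ hA) ihX ihY ihZ

end GeneratedWithin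

/-! ### Finite preorders as intersections of two-block preorders -/

/-- The preorder on a set in which `x ≤ y` means that each of the given subsets that contains `x`
contains `y` too. -/
def SeparatedBy {α : Type v} (_ : Finset (Set α)) : Type v := α

namespace SeparatedBy

variable {α : Type v} {U V : Finset (Set α)}

/-- The points of `SeparatedBy U` are those of `α`. -/
def equiv (U : Finset (Set α)) : α ≃ SeparatedBy U := Equiv.refl α

instance instPreorder : Preorder (SeparatedBy U) where
  le x y := ∀ u ∈ U, (equiv U).symm x ∈ u → (equiv U).symm y ∈ u
  le_refl _ _ _ h := h
  le_trans _ _ _ h₁ h₂ u hu h := h₂ u hu (h₁ u hu h)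

theorem le_iff {x y : SeparatedBy U} :
    x ≤ y ↔ ∀ u ∈ U, (equiv U).symm x ∈ u → (equiv U).symm y ∈ u :=
  Iff.rfl

instance instFinite [Finite α] : Finite (SeparatedBy U) := inferInstanceAs (Finite α)

noncomputable instance instLocallyFiniteOrder [Finite α] : LocallyFiniteOrder (SeparatedBy U) := by
  classical
  haveI := Fintype.ofFinite (SeparatedBy U)
  exact Fintype.toLocallyFiniteOrder

noncomputable instance instDecidableEq : DecidableEq (SeparatedBy U) := Classical.decEq _

/-- Passing to fewer subsets makes the preorder coarser. -/
def coarsen (U V : Finset (Set α)) : SeparatedBy V ≃ SeparatedBy U := (equiv V).symm.trans (equiv U)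

theorem monotone_coarsen (h : U ⊆ V) : Monotone (coarsen U V) :=
  fun _ _ hxy u hu => hxy u (h hu)

/-- A finite preorder is separated by its principal upper sets. -/
theorem exists_orderIso (Λ : Type v) [Preorder Λ] [Finite Λ] :
    ∃ U : Finset (Set Λ), Nonempty (Λ ≃o SeparatedBy U) := by
  classical
  have := Fintype.ofFinite Λ
  refine ⟨Finset.univ.image Set.Ici, ⟨⟨equiv _, fun {x y} => ?_⟩⟩⟩
  rw [le_iff]
  simp only [Finset.mem_image, Finset.mem_univ, true_and, forall_exists_index,
    forall_apply_eq_imp_iff, Equiv.symm_apply_apply, Set.mem_Ici]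
  exact ⟨fun h => h x le_rfl, fun h a ha => ha.trans h⟩

/-- A finite set separated by a single subset has one of the orders `m ← n`. -/
theorem exists_orderIso_twoBlock [Finite α] (U : Finset (Set α)) (u : Set α)
    (hU : ∀ x y : SeparatedBy U, x ≤ y ↔ ((equiv U).symm x ∈ u → (equiv U).symm y ∈ u)) :
    ∃ m n : ℕ, Nonempty (SeparatedBy U ≃o TwoBlock m n) := by
  classical
  have := Fintype.ofFinite α
  let e : TwoBlock (Fintype.card {x // x ∉ u}) (Fintype.card {x // ¬ x ∉ u}) ≃ α :=
    (Equiv.sumCongr (Fintype.equivFin _).symm (Fintype.equivFin _).symm).trans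
      (Equiv.sumCompl fun x => x ∉ u)
  have he (z) : e z ∈ u ↔ Sum.isRight z = true := by
    rcases z with z | z
    · exact iff_of_false ((Fintype.equivFin {x // x ∉ u}).symm z).2 Bool.false_ne_true
    · exact iff_of_true (not_not.1 ((Fintype.equivFin {x // ¬ x ∉ u}).symm z).2) rfl
  refine ⟨_, _, ⟨(OrderIso.symm ⟨e.trans (equiv U), fun {x y} => ?_⟩)⟩⟩
  rw [hU]
  simp only [Equiv.trans_apply, Equiv.symm_apply_apply, he]
  exact Iff.rfl

end SeparatedBy

/-! ### Incidence rings of finite preordered sets as iterated pullbacks -/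

section Generation

variable {P : Type u} [Ring P] [TopologicalSpace P] [IsTopologicalRing P]

open IncidenceAlgebra

theorem topIncidenceRings_of (Λ : Type u) [Preorder Λ] [LocallyFiniteOrder Λ] [DecidableEq Λ] :
    topIncidenceRings P (TopRingCat.of (IncidenceAlgebra P Λ)) :=
  ⟨Λ, inferInstance, inferInstance, inferInstance, ⟨Iso.refl _⟩⟩

/-- Order isomorphisms induce isomorphisms of incidence rings. -/
def topIsoOfOrderIso {α β : Type u} [Preorder α] [LocallyFiniteOrder α] [DecidableEq α]
    [Preorder β] [LocallyFiniteOrder β] [DecidableEq β] (e : α ≃o β) :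
    TopRingCat.of (IncidenceAlgebra P α) ≅ TopRingCat.of (IncidenceAlgebra P β) :=
  TopRingCat.isoMk (restrict (e.symm : β ↪o α) (ordConnected_range_orderIso _))
    (restrict (e : α ↪o β) (ordConnected_range_orderIso _))
    (continuous_restrict _ _) (continuous_restrict _ _)
    (fun A => by ext s t _; simp [restrict_apply]) (fun A => by ext s t _; simp [restrict_apply])

/-- Order isomorphisms with the small preorders `m ← n` induce isomorphisms of incidence rings. -/
def topIsoTwoBlock {α : Type u} [Preorder α] [LocallyFiniteOrder α] [DecidableEq α] {m n : ℕ}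
    (e : α ≃o TwoBlock m n) :
    TopRingCat.of (IncidenceAlgebra P α) ≅ TopRingCat.of (IncidenceAlgebra P (TwoBlock m n)) :=
  TopRingCat.isoMk (restrict (e.symm : TwoBlock m n ↪o α) (ordConnected_range_orderIso _))
    (restrict (e : α ↪o TwoBlock m n) (ordConnected_range_orderIso _))
    (continuous_restrict _ _) (continuous_restrict _ _)
    (fun A => by ext s t _; simp [restrict_apply]) (fun A => by ext s t _; simp [restrict_apply])

theorem topBlockRings_le : topBlockRings P ≤ topIncidenceRings P := by
  rintro _ ⟨m, n, rfl⟩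
  let e : ULift.{u} (TwoBlock m n) ≃o TwoBlock m n := ⟨Equiv.ulift, Iff.rfl⟩
  have : DecidableLE (ULift.{u} (TwoBlock m n)) := Classical.decRel _
  let : LocallyFiniteOrder (ULift.{u} (TwoBlock m n)) := Fintype.toLocallyFiniteOrder
  exact ⟨ULift.{u} (TwoBlock m n), inferInstance, inferInstance, inferInstance,
    ⟨(topIsoTwoBlock e).symm⟩⟩

theorem generated_of_orderIso_twoBlock {α : Type u} [Preorder α] [LocallyFiniteOrder α]
    [DecidableEq α] {m n : ℕ} (e : α ≃o TwoBlock m n) :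
    GeneratedWithin (topIncidenceRings P) (topBlockRings P)
      (TopRingCat.of (IncidenceAlgebra P α)) :=
  .of_iso (topIsoTwoBlock e) (topIncidenceRings_of α) (.generator _ ⟨m, n, rfl⟩)

/-- The inclusion of incidence rings that belongs to coarsening a preorder. -/
noncomputable def coarsenHom {α : Type u} [Finite α] {U V : Finset (Set α)} (h : U ⊆ V) :
    TopRingCat.of (IncidenceAlgebra P (SeparatedBy V)) ⟶
      TopRingCat.of (IncidenceAlgebra P (SeparatedBy U)) :=
  ⟨extend (SeparatedBy.coarsen U V) (SeparatedBy.monotone_coarsen h), continuous_extend _ _⟩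

open Classical in
/-- The incidence ring of an intersection of two preorders on a finite set is the intersection of
the incidence rings. -/
theorem isPullback_coarsenHom {α : Type u} [Finite α] (U V : Finset (Set α)) :
    IsPullback (coarsenHom (P := P) (Finset.subset_union_left (s₁ := U) (s₂ := V)))
      (coarsenHom Finset.subset_union_right)
      (coarsenHom (Finset.empty_subset U)) (coarsenHom (Finset.empty_subset V)) := by
  refine ⟨⟨rfl⟩, TopRingCat.nonempty_isLimit _ ?_ ?_ ?_⟩
  · intro A B h
    refine IncidenceAlgebra.ext fun s t _ => ?_
    exact congrArg (fun M : IncidenceAlgebra P (SeparatedBy U) => M s t) (h .left)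
  · intro x hx
    let a : IncidenceAlgebra P (SeparatedBy U) := x .left
    let b : IncidenceAlgebra P (SeparatedBy V) := x .right
    have hab (s t : α) : a s t = b s t :=
      congrArg (fun M : IncidenceAlgebra P (SeparatedBy (∅ : Finset (Set α))) => M s t)
        ((hx WalkingCospan.Hom.inl).trans (hx WalkingCospan.Hom.inr).symm)
    -- Two matrices that agree in the full matrix ring are one matrix supported on both preorders,
    -- hence on their intersection, the preorder of `U ∪ V`.
    let y : IncidenceAlgebra P (SeparatedBy (U ∪ V)) := ⟨fun s t => a s t, fun s t hst => by
      by_contra h0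
      refine hst fun u hu => ?_
      rcases Finset.mem_union.1 hu with hu | hu
      · exact le_of_ne_zero h0 u hu
      · exact le_of_ne_zero (α := SeparatedBy V) (f := b) (fun h => h0 ((hab s t).trans h)) u hu⟩
    have hl : (coarsenHom (Finset.subset_union_left (s₁ := U) (s₂ := V))).1 y = a := rfl
    have hr : (coarsenHom (Finset.subset_union_right (s₁ := U) (s₂ := V))).1 y = b :=
      IncidenceAlgebra.ext fun s t _ => hab s t
    refine ⟨y, ?_⟩
    rintro (_ | _ | _)
    · refine Eq.trans ?_ (hx WalkingCospan.Hom.inl)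
      exact congrArg (coarsenHom (Finset.empty_subset U)).1 hl
    · exact hl
    · exact hr
  · intro T f hf
    refine continuous_of_apply fun s t => ?_
    exact (continuous_apply_apply (Λ := SeparatedBy U) s t).comp (hf .left)

theorem generated_separatedBy {α : Type u} [Finite α] (U : Finset (Set α)) :
    GeneratedWithin (topIncidenceRings P) (topBlockRings P)
      (TopRingCat.of (IncidenceAlgebra P (SeparatedBy U))) := by
  classical
  have h0 : GeneratedWithin (topIncidenceRings P) (topBlockRings P)
      (TopRingCat.of (IncidenceAlgebra P (SeparatedBy (∅ : Finset (Set α))))) := by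
    -- The single set `univ` imposes no condition, just like the empty family: all points are
    -- equivalent.
    obtain ⟨m, n, ⟨e⟩⟩ := SeparatedBy.exists_orderIso_twoBlock (∅ : Finset (Set α)) Set.univ
      (by simp [SeparatedBy.le_iff])
    exact generated_of_orderIso_twoBlock e
  induction U using Finset.induction_on with
  | empty => exact h0
  | insert u U _ ih =>
    rw [Finset.insert_eq]
    obtain ⟨m, n, ⟨e⟩⟩ := SeparatedBy.exists_orderIso_twoBlock {u} u
      (by simp [SeparatedBy.le_iff])
    exact .pullback _ _ _ _ _ _ _ _ (isPullback_coarsenHom {u} U) (topIncidenceRings_of _)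
      (generated_of_orderIso_twoBlock e) ih h0

theorem generated_of_finite (Λ : Type u) [Preorder Λ] [LocallyFiniteOrder Λ] [DecidableEq Λ]
    [Finite Λ] :
    GeneratedWithin (topIncidenceRings P) (topBlockRings P)
      (TopRingCat.of (IncidenceAlgebra P Λ)) := by
  obtain ⟨U, ⟨e⟩⟩ := SeparatedBy.exists_orderIso Λ
  exact .of_iso (topIsoOfOrderIso e) (topIncidenceRings_of Λ) (generated_separatedBy U)

/-! ### Locally finite preordered sets as directed unions of finite convex subsets -/

/-- The finite order-convex subsets of a preordered set. -/
abbrev FiniteConvex (Λ : Type u) [Preorder Λ] : Type u :=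
  {s : Finset Λ // (s : Set Λ).OrdConnected}

/-- The union of the intervals between points of `s` is convex, and local finiteness makes it
finite. -/
theorem FiniteConvex.exists_superset {Λ : Type u} [Preorder Λ] [LocallyFiniteOrder Λ]
    (s : Finset Λ) : ∃ t : FiniteConvex Λ, s ⊆ t.1 := by
  classical
  refine ⟨⟨s.biUnion fun a => s.biUnion fun b => Finset.Icc a b, ⟨fun x hx y hy r hr => ?_⟩⟩, ?_⟩
  · simp only [Finset.coe_biUnion, Finset.mem_coe, Set.mem_iUnion, Finset.coe_Icc, Set.mem_Icc,
      exists_prop] at hx hy ⊢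
    obtain ⟨a, ha, _, _, hax, _⟩ := hx
    obtain ⟨_, _, b, hb, _, hyb⟩ := hy
    exact ⟨a, ha, b, hb, hax.trans hr.1, hr.2.trans hyb⟩
  · intro x hx
    simp only [Finset.mem_biUnion, Finset.mem_Icc]
    exact ⟨x, hx, x, hx, le_rfl, le_rfl⟩

instance FiniteConvex.instIsDirectedOrder {Λ : Type u} [Preorder Λ] [LocallyFiniteOrder Λ] :
    IsDirectedOrder (FiniteConvex Λ) where
  directed s t := by
    classical
    obtain ⟨r, hr⟩ := FiniteConvex.exists_superset (s.1 ∪ t.1)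
    exact ⟨r, Finset.union_subset_left hr, Finset.union_subset_right hr⟩

instance FiniteConvex.instNonempty {Λ : Type u} [Preorder Λ] [LocallyFiniteOrder Λ] :
    Nonempty (FiniteConvex Λ) :=
  ⟨(FiniteConvex.exists_superset ∅).choose⟩

namespace FiniteConvex

variable {Λ : Type u} [Preorder Λ]

/-- A finite order-convex subset is embedded into a larger one. -/
def inclusion {s t : FiniteConvex Λ} (h : s ≤ t) : s.1 ↪o t.1 where
  toFun x := ⟨x.1, h x.2⟩
  inj' _ _ hxy := Subtype.ext (congrArg (fun z : t.1 => z.1) hxy)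
  map_rel_iff' := Iff.rfl

theorem ordConnected_range_inclusion {s t : FiniteConvex Λ} (h : s ≤ t) :
    (Set.range (inclusion h)).OrdConnected where
  out' := by
    rintro _ ⟨x, rfl⟩ _ ⟨y, rfl⟩ r hr
    exact ⟨⟨r.1, s.2.out x.2 y.2 hr⟩, rfl⟩

theorem ordConnected_range_subtype (s : FiniteConvex Λ) :
    (Set.range (OrderEmbedding.subtype (· ∈ s.1))).OrdConnected where
  out' := by
    rintro _ ⟨x, rfl⟩ _ ⟨y, rfl⟩ r hr
    exact ⟨⟨r, s.2.out x.2 y.2 hr⟩, rfl⟩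

variable [LocallyFiniteOrder Λ] [DecidableEq Λ]

/-- The inverse system of the incidence rings of the finite order-convex subsets. -/
def system (P : Type u) [Ring P] [TopologicalSpace P] [IsTopologicalRing P] (Λ : Type u)
    [Preorder Λ] [LocallyFiniteOrder Λ] [DecidableEq Λ] : (FiniteConvex Λ)ᵒᵖ ⥤ TopRingCat.{u} where
  obj s := TopRingCat.of (IncidenceAlgebra P s.unop.1)
  map f := ⟨restrict (inclusion f.unop.le) (ordConnected_range_inclusion _),
    continuous_restrict _ _⟩

/-- The cone of the restrictions to the finite order-convex subsets. -/
def cone (P : Type u) [Ring P] [TopologicalSpace P] [IsTopologicalRing P] (Λ : Type u)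
    [Preorder Λ] [LocallyFiniteOrder Λ] [DecidableEq Λ] : Cone (system P Λ) where
  pt := TopRingCat.of (IncidenceAlgebra P Λ)
  π :=
    { app := fun s => ⟨restrict (OrderEmbedding.subtype (· ∈ s.unop.1))
        (ordConnected_range_subtype s.unop), continuous_restrict _ _⟩ }

theorem nonempty_isLimit_cone : Nonempty (IsLimit (cone P Λ)) := by
  have key (a b : Λ) : ∃ t : FiniteConvex Λ, a ∈ t.1 ∧ b ∈ t.1 := by
    obtain ⟨t, ht⟩ := exists_superset ({a, b} : Finset Λ)
    exact ⟨t, ht (by simp), ht (by simp)⟩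
  choose S hS₁ hS₂ using key
  refine TopRingCat.nonempty_isLimit _ ?_ ?_ ?_
  · intro A B h
    refine IncidenceAlgebra.ext fun a b _ => ?_
    exact congrArg (fun M : IncidenceAlgebra P (S a b).1 => M ⟨a, hS₁ a b⟩ ⟨b, hS₂ a b⟩)
      (h (.op (S a b)))
  · intro x hx
    let z (s : FiniteConvex Λ) : IncidenceAlgebra P s.1 := x (.op s)
    have hz {s t : FiniteConvex Λ} (h : s ≤ t) (a b : Λ) (ha : a ∈ s.1) (hb : b ∈ s.1) :
        z t ⟨a, h ha⟩ ⟨b, h hb⟩ = z s ⟨a, ha⟩ ⟨b, hb⟩ :=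
      congrArg (fun M : IncidenceAlgebra P s.1 => M ⟨a, ha⟩ ⟨b, hb⟩) (hx (homOfLE h).op)
    let y : IncidenceAlgebra P Λ := ⟨fun a b => z (S a b) ⟨a, hS₁ a b⟩ ⟨b, hS₂ a b⟩,
      fun a b hab => apply_eq_zero_of_not_le
        (a := (⟨a, hS₁ a b⟩ : (S a b).1)) (b := ⟨b, hS₂ a b⟩) hab _⟩
    refine ⟨y, fun ⟨s⟩ => ?_⟩
    refine IncidenceAlgebra.ext (𝕜 := P) (α := s.1) fun ⟨a, ha⟩ ⟨b, hb⟩ _ => ?_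
    obtain ⟨t, hst, hSt⟩ := exists_ge_ge s (S a b)
    exact (hz hSt a b (hS₁ a b) (hS₂ a b)).symm.trans (hz hst a b ha hb)
  · intro T f hf
    refine continuous_of_apply fun a b => ?_
    exact (continuous_apply_apply (Λ := (S a b).1) ⟨a, hS₁ a b⟩ ⟨b, hS₂ a b⟩).comp
      (hf (.op (S a b)))

end FiniteConvex

/-- Every topological incidence ring is generated by the rings `M_{m ← n}(P)`, all the intermediate
rings being incidence rings. -/
theorem generated_topIncidenceRing (Λ : Type u) [Preorder Λ] [LocallyFiniteOrder Λ]
    [DecidableEq Λ] :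
    GeneratedWithin (topIncidenceRings P) (topBlockRings P)
      (TopRingCat.of (IncidenceAlgebra P Λ)) := by
  obtain ⟨h⟩ := FiniteConvex.nonempty_isLimit_cone (P := P) (Λ := Λ)
  exact .inverseLimit (FiniteConvex Λ) (FiniteConvex.system P Λ) (FiniteConvex.cone P Λ) ⟨h⟩
    (topIncidenceRings_of Λ) fun s => generated_of_finite s.unop.1

end Generation

/-! ### Rings without topology, and the theorem -/

/-- Every incidence ring is generated by the rings `M_{m ← n}(P)`, all the intermediate rings being
incidence rings. -/
theorem generated_incidenceRing {P : Type u} [Ring P] (Λ : Type u) [Preorder Λ]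
    [LocallyFiniteOrder Λ] [DecidableEq Λ] :
    GeneratedWithin (incidenceRings P) (blockRings P)
      (RingCat.of (IncidenceAlgebra P Λ)) := by
  -- Some ring topology on `P` is needed to apply the topological result; the discrete one always
  -- exists.
  let : TopologicalSpace P := ⊥
  have : DiscreteTopology P := ⟨rfl⟩
  have := TopRingCat.discreteAdjunction.{u}.rightAdjoint_preservesLimits.{u, u}
  have := TopRingCat.discreteAdjunction.{u}.rightAdjoint_preservesLimits.{0, 0}
  refine (generated_topIncidenceRing (P := P) Λ).map TopRingCat.forgetTopology ?_ ?_
  · rintro X ⟨Λ, _, _, _, ⟨e⟩⟩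
    exact ⟨Λ, _, _, _, ⟨TopRingCat.forgetTopology.mapIso e⟩⟩
  · rintro _ ⟨m, n, rfl⟩
    exact ⟨m, n, rfl⟩

theorem blockRings_le {P : Type u} [Ring P] : blockRings P ≤ incidenceRings P := by
  rintro _ ⟨m, n, rfl⟩
  let : TopologicalSpace P := ⊥
  have : DiscreteTopology P := ⟨rfl⟩
  obtain ⟨Λ, _, _, _, ⟨e⟩⟩ := topBlockRings_le (P := P) _ ⟨m, n, rfl⟩
  exact ⟨Λ, _, _, _, ⟨TopRingCat.forgetTopology.mapIso e⟩⟩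

theorem mainTheorem7 (P : Type u) [Ring P] :
    ((∀ (Λ : Type u) [PartialOrder Λ] [LocallyFiniteOrder Λ] [DecidableEq Λ],
        GeneratedWithin ⊤ (blockRings P) (RingCat.of (IncidenceAlgebra P Λ))) ∧
      GeneratedWithin (incidenceRings P) (blockRings P) = incidenceRings P) ∧
    ∀ [TopologicalSpace P] [IsTopologicalRing P],
      (∀ (Λ : Type u) [PartialOrder Λ] [LocallyFiniteOrder Λ] [DecidableEq Λ],
        GeneratedWithin ⊤ (topBlockRings P) (TopRingCat.of (IncidenceAlgebra P Λ))) ∧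
      GeneratedWithin (topIncidenceRings P) (topBlockRings P) = topIncidenceRings P := by
  refine ⟨⟨fun Λ _ _ _ => GeneratedWithin.mono le_top _ (generated_incidenceRing Λ),
    le_antisymm (GeneratedWithin.le_of_le blockRings_le) ?_⟩, fun {_ _} =>
    ⟨fun Λ _ _ _ => GeneratedWithin.mono le_top _ (generated_topIncidenceRing Λ),
      le_antisymm (GeneratedWithin.le_of_le topBlockRings_le) ?_⟩⟩
  · rintro R ⟨Λ, _, _, _, ⟨e⟩⟩
    exact .of_iso e ⟨Λ, _, _, _, ⟨e⟩⟩ (generated_incidenceRing Λ)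
  · rintro R ⟨Λ, _, _, _, ⟨e⟩⟩
    exact .of_iso e ⟨Λ, _, _, _, ⟨e⟩⟩ (generated_topIncidenceRing Λ)
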